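/- Let $\mathcal M$ be a von Neumann algebra with a faithful normal tracial state $\tau$ (so $\mathcal M$ is finite), and let $\mathcal M_h$ be the real Banach space of its self-adjoint elements with the operator norm. For positive invertible $a,b\in\mathcal M$ put $$\gamma_{a,b}(t)=a^{1/2}\bigl(a^{-1/2}\,b\,a^{-1/2}\bigr)^{t}a^{1/2}\qquad(t\in\mathbb R).$$ A set $K$ of positive invertible elements of $\mathcal M$ is called geodesically convex if $\gamma_{a,b}(t)\in K$ for all $a,b\in K$ and all $t\in[0,1]$. Let $H\subseteq\mathcal M_h$ be a norm-closed real linear subspace and let $K=\exp(H)=\{e^x : x\in H\}$. Then $K$ is geodesically convex if and only if $H$ is a Lie triple system, that is, $[x,[x,y]]\in H$ for all $x,y\in H$, where $[x,y]=xy-yx$. -/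

import Mathlib

open scoped ComplexOrder

/-- `τ` is a faithful normal tracial state on `M`. Normality is the preservation of suprema of
(bounded, upward) directed sets of self-adjoint elements. -/
structure IsFaithfulNormalTracialState {M : Type*} [CStarAlgebra M] [PartialOrder M]
    (τ : M →ₗ[ℂ] ℂ) : Prop where
  map_one : τ 1 = 1
  nonneg : ∀ x : M, 0 ≤ x → 0 ≤ τ x
  faithful : ∀ x : M, τ (star x * x) = 0 → x = 0
  tracial : ∀ x y : M, τ (x * y) = τ (y * x)
  normal : ∀ (D : Set M) (s : M), (∀ x ∈ D, IsSelfAdjoint x) → D.Nonempty →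
    DirectedOn (· ≤ ·) D → IsLUB D s → IsLUB ((fun x => (τ x).re) '' D) (τ s).re

/-- A real subspace `H` is a Lie triple system if `[x, [x, y]] ∈ H` for all `x, y ∈ H`,
where `[x, y] = x * y - y * x`. -/
def IsLieTripleSystem {M : Type*} [CStarAlgebra M] (H : Submodule ℝ M) : Prop :=
  ∀ x ∈ H, ∀ y ∈ H, ⁅x, ⁅x, y⁆⁆ ∈ H

/-- The curve `γ_{a,b}(t) = a^{1/2} (a^{-1/2} b a^{-1/2})^t a^{1/2}` through positive invertible
`a` and `b`; the real powers are those of the continuous functional calculus. -/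
noncomputable def geodesicCurve {M : Type*} [CStarAlgebra M] [PartialOrder M] [StarOrderedRing M]
    (a b : M) (t : ℝ) : M :=
  a ^ (1 / 2 : ℝ) * (a ^ (-(1 / 2) : ℝ) * b * a ^ (-(1 / 2) : ℝ)) ^ t * a ^ (1 / 2 : ℝ)

/-- A set `K` of positive invertible elements is geodesically convex if `γ_{a,b}(t) ∈ K` for all
`a, b ∈ K` and all `t ∈ [0, 1]`. -/
def IsGeodesicallyConvex {M : Type*} [CStarAlgebra M] [PartialOrder M] [StarOrderedRing M]
    (K : Set M) : Prop :=
  ∀ a ∈ K, ∀ b ∈ K, ∀ t ∈ Set.Icc (0 : ℝ) 1, geodesicCurve a b t ∈ K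

section BanachAlgebra

open NormedSpace MeasureTheory

variable {A : Type*} [NormedRing A] [NormedAlgebra ℝ A]

/-- The inner derivation `v ↦ c v - v c` as a continuous linear map. -/
noncomputable def adCLM (c : A) : A →L[ℝ] A :=
  ContinuousLinearMap.mul ℝ A c - (ContinuousLinearMap.mul ℝ A).flip c

theorem adCLM_apply (c v : A) : adCLM c v = ⁅c, v⁆ := by
  simp [adCLM, Ring.lie_def]

theorem adCLM_neg (c : A) : adCLM (-c) = -adCLM c := by
  ext v
  simp only [adCLM_apply, neg_apply, Ring.lie_def]
  noncomm_ring

variable [CompleteSpace A]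

theorem continuous_exp_of_real : Continuous (exp : A → A) := by
  let +nondep : NormedAlgebra ℚ A := .restrictScalars ℚ ℝ A
  exact exp_continuous

theorem exp_add_smul (c : A) (s t : ℝ) : exp ((s + t) • c) = exp (s • c) * exp (t • c) := by
  let +nondep : NormedAlgebra ℚ A := .restrictScalars ℚ ℝ A
  rw [add_smul]
  exact exp_add_of_commute (((Commute.refl c).smul_left s).smul_right t)

theorem exp_mul_exp_neg (c : A) : exp c * exp (-c) = 1 := by
  have h := exp_add_smul c 1 (-1)
  simpa using h.symm

theorem exp_neg_mul_exp (c : A) : exp (-c) * exp c = 1 := by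
  have h := exp_add_smul c (-1) 1
  simpa using h.symm

theorem norm_exp_le_exp_norm_of_real [NormOneClass A] (c : A) : ‖exp c‖ ≤ Real.exp ‖c‖ := by
  have h1 := exp_series_hasSum_exp' (𝕂 := ℝ) c
  have h2 := exp_series_hasSum_exp' (𝕂 := ℝ) ‖c‖
  rw [← Real.exp_eq_exp_ℝ] at h2
  rw [← h1.tsum_eq]
  refine tsum_of_norm_bounded h2 fun n => ?_
  rw [norm_smul, norm_inv, Real.norm_natCast, smul_eq_mul]
  gcongr
  exact norm_pow_le c n

theorem norm_exp_smul_le [NormOneClass A] (c : A) {s R : ℝ} (hR : ‖c‖ ≤ R) (hs : |s| ≤ 1) :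
    ‖exp (s • c)‖ ≤ Real.exp R := by
  refine (norm_exp_le_exp_norm_of_real _).trans (Real.exp_le_exp.2 ?_)
  rw [norm_smul, Real.norm_eq_abs]
  nlinarith [norm_nonneg c, abs_nonneg s]

/-- Duhamel's formula. -/
theorem exp_add_sub_exp_eq_integral (c w : A) :
    exp (c + w) - exp c = ∫ s in (0 : ℝ)..1, exp (s • (c + w)) * w * exp ((1 - s) • c) := by
  have hd : ∀ s : ℝ, HasDerivAt (fun s : ℝ => exp (s • (c + w)) * exp ((1 - s) • c))
      (exp (s • (c + w)) * w * exp ((1 - s) • c)) s := by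
    intro s
    have h1 := hasDerivAt_exp_smul_const (c + w) s
    have h2 : HasDerivAt (fun s : ℝ => exp ((1 - s) • c)) ((-1 : ℝ) • (c * exp ((1 - s) • c))) s :=
      (hasDerivAt_exp_smul_const' c (1 - s)).scomp s ((hasDerivAt_id s).const_sub 1)
    refine (h1.mul h2).congr_deriv ?_
    simp only [neg_smul, one_smul, mul_add, add_mul, mul_neg, mul_assoc]
    abel
  have hc := continuous_exp_of_real (A := A)
  have := intervalIntegral.integral_eq_sub_of_hasDerivAt (a := 0) (b := 1) (fun s _ => hd s)
    (Continuous.intervalIntegrable (by fun_prop) _ _)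
  rw [this]
  simp

theorem norm_exp_add_sub_exp_le [NormOneClass A] (c w : A) :
    ‖exp (c + w) - exp c‖ ≤ Real.exp (2 * (‖c‖ + ‖w‖)) * ‖w‖ := by
  rw [exp_add_sub_exp_eq_integral]
  have h := intervalIntegral.norm_integral_le_of_norm_le_const (a := (0 : ℝ)) (b := 1)
    (f := fun s : ℝ => exp (s • (c + w)) * w * exp ((1 - s) • c))
    (C := Real.exp (2 * (‖c‖ + ‖w‖)) * ‖w‖) ?_
  · simpa using h
  · intro s hs
    rw [Set.uIoc_of_le zero_le_one] at hs
    have h1 := norm_exp_smul_le (c + w) (s := s) (norm_add_le c w)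
      (abs_le.2 ⟨by linarith [hs.1], hs.2⟩)
    have h2 := norm_exp_smul_le c (s := 1 - s) (R := ‖c‖ + ‖w‖) (by linarith [norm_nonneg w])
      (abs_le.2 ⟨by linarith [hs.2], by linarith [hs.1]⟩)
    calc ‖exp (s • (c + w)) * w * exp ((1 - s) • c)‖
        ≤ ‖exp (s • (c + w))‖ * ‖w‖ * ‖exp ((1 - s) • c)‖ := norm_mul₃_le
      _ ≤ Real.exp (‖c‖ + ‖w‖) * ‖w‖ * Real.exp (‖c‖ + ‖w‖) := by gcongr
      _ = _ := by rw [two_mul (‖c‖ + ‖w‖), Real.exp_add (‖c‖ + ‖w‖)]; ring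

/-- The derivative of the exponential at `c`, in Duhamel's form. -/
noncomputable def dexp (c : A) : A →L[ℝ] A :=
  ∫ s in (0 : ℝ)..1, ContinuousLinearMap.mulLeftRight ℝ A (exp (s • c)) (exp ((1 - s) • c))

/-- The operator `sinh (ad c / 2) / (ad c / 2)`, as the mean of the conjugations by `exp (s c)`,
`|s| ≤ 1 / 2`. -/
noncomputable def sinhcAd (c : A) : A →L[ℝ] A :=
  ∫ s in (-(1 / 2) : ℝ)..(1 / 2),
    ContinuousLinearMap.mulLeftRight ℝ A (exp (s • c)) (exp ((-s) • c))

theorem dexp_apply (c v : A) :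
    dexp c v = ∫ s in (0 : ℝ)..1, exp (s • c) * v * exp ((1 - s) • c) := by
  have hc := continuous_exp_of_real (A := A)
  rw [dexp, ContinuousLinearMap.intervalIntegral_apply
    (Continuous.intervalIntegrable (by fun_prop) _ _)]
  simp

theorem sinhcAd_apply (c v : A) :
    sinhcAd c v = ∫ s in (-(1 / 2) : ℝ)..(1 / 2), exp (s • c) * v * exp ((-s) • c) := by
  have hc := continuous_exp_of_real (A := A)
  rw [sinhcAd, ContinuousLinearMap.intervalIntegral_apply
    (Continuous.intervalIntegrable (by fun_prop) _ _)]
  simp only [ContinuousLinearMap.mulLeftRight_apply]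

theorem norm_exp_add_sub_exp_sub_dexp_le [NormOneClass A] (c w : A) :
    ‖exp (c + w) - exp c - dexp c w‖ ≤ Real.exp (3 * (‖c‖ + ‖w‖)) * ‖w‖ ^ 2 := by
  have hc := continuous_exp_of_real (A := A)
  rw [exp_add_sub_exp_eq_integral, dexp_apply, ← intervalIntegral.integral_sub
    (Continuous.intervalIntegrable (by fun_prop) _ _)
    (Continuous.intervalIntegrable (by fun_prop) _ _)]
  have h := intervalIntegral.norm_integral_le_of_norm_le_const (a := (0 : ℝ)) (b := 1)
    (f := fun s : ℝ => exp (s • (c + w)) * w * exp ((1 - s) • c) -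
      exp (s • c) * w * exp ((1 - s) • c))
    (C := Real.exp (3 * (‖c‖ + ‖w‖)) * ‖w‖ ^ 2) ?_
  · simpa using h
  · intro s hs
    rw [Set.uIoc_of_le zero_le_one] at hs
    have h1 : ‖exp (s • c + s • w) - exp (s • c)‖ ≤ Real.exp (2 * (‖c‖ + ‖w‖)) * ‖w‖ := by
      refine (norm_exp_add_sub_exp_le _ _).trans ?_
      simp only [norm_smul, Real.norm_of_nonneg hs.1.le]
      have hsc : s * ‖c‖ ≤ ‖c‖ := mul_le_of_le_one_left (norm_nonneg c) hs.2
      have hsw : s * ‖w‖ ≤ ‖w‖ := mul_le_of_le_one_left (norm_nonneg w) hs.2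
      have hs0 := hs.1.le
      gcongr
    have h2 := norm_exp_smul_le c (s := 1 - s) (R := ‖c‖ + ‖w‖) (by linarith [norm_nonneg w])
      (abs_le.2 ⟨by linarith [hs.2], by linarith [hs.1]⟩)
    rw [← sub_mul, ← sub_mul, smul_add]
    calc ‖(exp (s • c + s • w) - exp (s • c)) * w * exp ((1 - s) • c)‖
        ≤ ‖exp (s • c + s • w) - exp (s • c)‖ * ‖w‖ * ‖exp ((1 - s) • c)‖ := norm_mul₃_le
      _ ≤ (Real.exp (2 * (‖c‖ + ‖w‖)) * ‖w‖) * ‖w‖ * Real.exp (‖c‖ + ‖w‖) := by gcongr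
      _ = _ := by
        rw [show 3 * (‖c‖ + ‖w‖) = 2 * (‖c‖ + ‖w‖) + (‖c‖ + ‖w‖) by ring,
          Real.exp_add (2 * (‖c‖ + ‖w‖))]; ring

theorem mul_integral_conj_mul (c v : A) (p q a b : ℝ) :
    exp (p • c) * (∫ s in a..b, exp (s • c) * v * exp ((-s) • c)) * exp (q • c) =
      ∫ s in a..b, exp ((s + p) • c) * v * exp ((q - s) • c) := by
  have hc := continuous_exp_of_real (A := A)
  have h := (ContinuousLinearMap.mulLeftRight ℝ A (exp (p • c))
    (exp (q • c))).intervalIntegral_comp_comm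
    (f := fun s : ℝ => exp (s • c) * v * exp ((-s) • c)) (μ := volume) (a := a) (b := b)
    (Continuous.intervalIntegrable (by fun_prop) _ _)
  rw [ContinuousLinearMap.mulLeftRight_apply] at h
  rw [← h]
  refine intervalIntegral.integral_congr fun s _ => ?_
  simp only [ContinuousLinearMap.mulLeftRight_apply]
  rw [add_comm s p, exp_add_smul, sub_eq_neg_add, exp_add_smul]
  simp only [mul_assoc]

theorem dexp_apply_eq_mul_sinhcAd_mul (c v : A) :
    dexp c v = exp ((1 / 2 : ℝ) • c) * sinhcAd c v * exp ((1 / 2 : ℝ) • c) := by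
  rw [sinhcAd_apply, mul_integral_conj_mul, dexp_apply]
  have := intervalIntegral.integral_comp_add_right (a := -(1 / 2)) (b := 1 / 2)
    (fun s : ℝ => exp (s • c) * v * exp ((1 - s) • c)) (1 / 2)
  norm_num at this ⊢
  rw [← this]
  refine intervalIntegral.integral_congr fun s _ => ?_
  congr 3
  ring

theorem sinhcAd_smul_half (c v : A) :
    sinhcAd c v = (1 / 2 : ℝ) • (exp ((1 / 4 : ℝ) • c) * sinhcAd ((1 / 2 : ℝ) • c) v *
        exp (-((1 / 4 : ℝ) • c)) +
      exp (-((1 / 4 : ℝ) • c)) * sinhcAd ((1 / 2 : ℝ) • c) v * exp ((1 / 4 : ℝ) • c)) := by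
  have hc := continuous_exp_of_real (A := A)
  have e1 : sinhcAd ((1 / 2 : ℝ) • c) v =
      (2 : ℝ) • ∫ s in (-(1 / 4) : ℝ)..(1 / 4), exp (s • c) * v * exp ((-s) • c) := by
    rw [sinhcAd_apply]
    have := intervalIntegral.integral_comp_mul_right (a := -(1 / 2)) (b := 1 / 2)
      (fun s : ℝ => exp (s • c) * v * exp ((-s) • c)) (c := 1 / 2) (by norm_num)
    norm_num at this ⊢
    rw [← this]
    refine intervalIntegral.integral_congr fun s _ => ?_
    simp [smul_smul]
  have key : ∀ p : ℝ, exp (p • c) * sinhcAd ((1 / 2 : ℝ) • c) v * exp ((-p) • c) =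
      (2 : ℝ) • ∫ s in (-(1 / 4) + p : ℝ)..(1 / 4 + p), exp (s • c) * v * exp ((-s) • c) := by
    intro p
    rw [e1, mul_smul_comm, smul_mul_assoc, mul_integral_conj_mul]
    have := intervalIntegral.integral_comp_add_right (a := -(1 / 4)) (b := 1 / 4)
      (fun s : ℝ => exp (s • c) * v * exp ((-s) • c)) p
    rw [← this]
    congr 1
    refine intervalIntegral.integral_congr fun s _ => ?_
    congr 3
    ring
  have k1 := key (1 / 4)
  have k2 := key (-(1 / 4))
  rw [neg_neg] at k2
  rw [← neg_smul, k1, k2, ← smul_add, smul_smul, sinhcAd_apply]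
  norm_num
  rw [add_comm, intervalIntegral.integral_add_adjacent_intervals
    (Continuous.intervalIntegrable (by fun_prop) _ _)
    (Continuous.intervalIntegrable (by fun_prop) _ _)]

theorem sinhcAd_zero : sinhcAd (0 : A) = 1 := by
  ext v
  rw [sinhcAd_apply]
  norm_num

theorem continuous_sinhcAd : Continuous (sinhcAd : A → A →L[ℝ] A) := by
  have hc := continuous_exp_of_real (A := A)
  unfold sinhcAd
  refine intervalIntegral.continuous_parametric_intervalIntegral_of_continuous' ?_ _ _
  unfold Function.uncurry
  fun_prop

theorem exp_adCLM_apply (c v : A) : exp (adCLM c) v = exp c * v * exp (-c) := by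
  let L : A →L[ℝ] A := ContinuousLinearMap.mul ℝ A c
  let R : A →L[ℝ] A := (ContinuousLinearMap.mul ℝ A).flip c
  let +nondep : NormedAlgebra ℚ (A →L[ℝ] A) := .restrictScalars ℚ ℝ (A →L[ℝ] A)
  let +nondep : NormedAlgebra ℚ A := .restrictScalars ℚ ℝ A
  have hLR : Commute L R := by
    ext w
    simp [L, R, mul_assoc]
  have hLp : ∀ (n : ℕ) (w : A), (L ^ n) w = c ^ n * w := by
    intro n
    induction n with
    | zero => simp
    | succ n ih => intro w; simp [pow_succ, ih, L, mul_assoc]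
  have hRp : ∀ (n : ℕ) (w : A), ((-R) ^ n) w = w * (-c) ^ n := by
    intro n
    induction n with
    | zero => simp
    | succ n ih => intro w; rw [pow_succ, pow_succ']; simp [ih, R, mul_assoc]
  have hL : ∀ w, exp L w = exp c * w := by
    intro w
    have h1 := (exp_series_hasSum_exp' (𝕂 := ℝ) L).mapL (ContinuousLinearMap.apply ℝ A w)
    have h2 := (exp_series_hasSum_exp' (𝕂 := ℝ) c).mul_right w
    refine h1.unique ?_
    simpa [hLp] using h2
  have hR : ∀ w, exp (-R) w = w * exp (-c) := by
    intro w
    have h1 := (exp_series_hasSum_exp' (𝕂 := ℝ) (-R)).mapL (ContinuousLinearMap.apply ℝ A w)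
    have h2 := (exp_series_hasSum_exp' (𝕂 := ℝ) (-c)).mul_left w
    refine h1.unique ?_
    simpa [hRp] using h2
  rw [adCLM, show ContinuousLinearMap.mul ℝ A c - (ContinuousLinearMap.mul ℝ A).flip c =
    L + -R from sub_eq_add_neg _ _, exp_add_of_commute hLR.neg_right,
    mul_apply_eq_comp, hL, hR, mul_assoc]

variable {H : Submodule ℝ A}

theorem exp_conj_add_exp_neg_conj_mem (hH : IsClosed (H : Set A)) {c : A}
    (hc : ∀ v ∈ H, ⁅c, ⁅c, v⁆⁆ ∈ H) {v : A} (hv : v ∈ H) :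
    exp c * v * exp (-c) + exp (-c) * v * exp c ∈ H := by
  have h1 := (exp_series_hasSum_exp' (𝕂 := ℝ) (adCLM c)).mapL (ContinuousLinearMap.apply ℝ A v)
  have h2 := (exp_series_hasSum_exp' (𝕂 := ℝ) (adCLM (-c))).mapL
    (ContinuousLinearMap.apply ℝ A v)
  have h3 := h1.add h2
  simp only [ContinuousLinearMap.apply_apply, exp_adCLM_apply, neg_neg] at h3
  refine hH.mem_of_tendsto h3 (Filter.Eventually.of_forall fun s => H.sum_mem fun n _ => ?_)
  have hpow : ∀ k : ℕ, ((adCLM c) ^ (2 * k)) v ∈ H := by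
    intro k
    induction k with
    | zero => simpa
    | succ k ih =>
      rw [show 2 * (k + 1) = 1 + 1 + 2 * k by ring, pow_add, pow_add, pow_one]
      simp only [mul_apply_eq_comp, adCLM_apply]
      exact hc _ ih
  rw [adCLM_neg]
  rcases Nat.even_or_odd n with hn | hn
  · have e : (-adCLM c) ^ n = adCLM c ^ n := hn.neg_pow (α := A →L[ℝ] A) (adCLM c)
    rw [e]
    obtain ⟨k, rfl⟩ := hn
    rw [← two_mul k]
    exact H.add_mem (H.smul_mem _ (hpow k)) (H.smul_mem _ (hpow k))
  · have e : (-adCLM c) ^ n = -adCLM c ^ n := hn.neg_pow (α := A →L[ℝ] A) (adCLM c)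
    rw [e]
    simp

theorem sinhcAd_mem (hH : IsClosed (H : Set A)) {c : A}
    (hc : ∀ v ∈ H, ⁅c, ⁅c, v⁆⁆ ∈ H) {v : A} (hv : v ∈ H) : sinhcAd c v ∈ H := by
  have hce := continuous_exp_of_real (A := A)
  let f : ℝ → A := fun s => exp (s • c) * v * exp ((-s) • c)
  have hf : Continuous f := by unfold f; fun_prop
  have hneg : sinhcAd c v = ∫ s in (-(1 / 2) : ℝ)..(1 / 2), f (-s) := by
    rw [sinhcAd_apply, intervalIntegral.integral_comp_neg (fun s => f s)]
    norm_num [f]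
  have hsum : (2 : ℝ) • sinhcAd c v = ∫ s in (-(1 / 2) : ℝ)..(1 / 2), (f s + f (-s)) := by
    rw [intervalIntegral.integral_add (hf.intervalIntegrable _ _)
      (Continuous.intervalIntegrable (by fun_prop) _ _), ← hneg, two_smul, sinhcAd_apply]
  have hmem : ∀ s, f s + f (-s) ∈ H := by
    intro s
    have := exp_conj_add_exp_neg_conj_mem hH (c := s • c) (fun w hw => by
      have := H.smul_mem s (H.smul_mem s (hc w hw))
      simpa only [Ring.lie_def, smul_mul_assoc, mul_smul_comm, ← smul_sub] using this) hv
    simpa [f] using this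
  have : IsClosed (H : Set A) := hH
  have hq : H.mkQL ((2 : ℝ) • sinhcAd c v) = 0 := by
    rw [hsum, ← ContinuousLinearMap.intervalIntegral_comp_comm]
    · have : ∀ s, H.mkQL (f s + f (-s)) = 0 := fun s =>
        (Submodule.Quotient.mk_eq_zero H).2 (hmem s)
      simp only [this, intervalIntegral.integral_zero]
    · exact (hf.add (hf.comp continuous_neg)).intervalIntegrable _ _
  have h2 : (2 : ℝ) • sinhcAd c v ∈ H := (Submodule.Quotient.mk_eq_zero H).1 hq
  simpa using H.smul_mem (1 / 2 : ℝ) h2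

end BanachAlgebra

section MethodOfContinuity

/-- The method of continuity: a path of operators that are bounded below by `1`, starting at the
identity, consists of invertible operators. -/
theorem isUnit_of_continuous_of_norm_le {E : Type*} [NormedAddCommGroup E] [NormedSpace ℝ E]
    [CompleteSpace E] {T : ℝ → E →L[ℝ] E} (hT : Continuous T) (h0 : T 0 = 1)
    (hb : ∀ r v, ‖v‖ ≤ ‖T r v‖) (r : ℝ) : IsUnit (T r) := by
  have hopen : IsOpen {r | IsUnit (T r)} := Units.isOpen.preimage hT
  refine isPreconnected_univ.subset_of_closure_inter_subset hopen
    ⟨0, trivial, by simp [h0]⟩ ?_ (Set.mem_univ r)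
  rintro s ⟨hs, -⟩
  obtain ⟨t, ht, hts⟩ := mem_closure_iff_nhds.1 hs {t | ‖T t - T s‖ < 1}
    (by
      have : Filter.Tendsto (fun t => ‖T t - T s‖) (nhds s) (nhds ‖T s - T s‖) :=
        ((hT.sub continuous_const).norm).tendsto s
      rw [sub_self, norm_zero] at this
      exact this.eventually_lt_const one_pos)
  obtain ⟨u, hu⟩ := hts
  have hinv : ‖(↑u⁻¹ : E →L[ℝ] E)‖ ≤ 1 := by
    refine ContinuousLinearMap.opNorm_le_bound _ zero_le_one fun v => ?_
    rw [one_mul]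
    refine (hb t _).trans ?_
    rw [← hu, ← mul_apply_eq_comp, u.mul_inv, one_apply_eq_self]
  have hlt : ‖(↑u⁻¹ : E →L[ℝ] E) * (T t - T s)‖ < 1 :=
    (norm_mul_le _ _).trans_lt <| (mul_le_of_le_one_left (norm_nonneg _) hinv).trans_lt ht
  have h1 := (isUnit_one_sub_of_norm_lt_one hlt)
  have h2 : T s = u * (1 - (↑u⁻¹ : E →L[ℝ] E) * (T t - T s)) := by
    rw [mul_sub, ← mul_assoc, u.mul_inv, hu]
    simp
  change IsUnit (T s)
  rw [h2]
  exact u.isUnit.mul h1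

end MethodOfContinuity

section CStar

open NormedSpace

variable {M : Type*} [CStarAlgebra M]

/-- An element of a C⋆-algebra with strictly positive real part is invertible. -/
theorem isUnit_of_algebraMap_le_add_star [PartialOrder M] [StarOrderedRing M] {z : M} {ε : ℝ}
    (hε : 0 < ε) (hz : algebraMap ℝ M ε ≤ z + star z) : IsUnit z := by
  let s : ℝ := ε / (2 * (‖z‖ ^ 2 + 1))
  have hs : 0 < s := by positivity
  have hsN : s * ‖z‖ ^ 2 ≤ ε / 2 := by
    have : s * (‖z‖ ^ 2 + 1) = ε / 2 := by
      unfold s; field_simp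
    linarith
  have hle : star (1 - s • z) * (1 - s • z) ≤ algebraMap ℝ M (max (1 - s * ε / 2) 0) := by
    have e1 : star (1 - s • z) * (1 - s • z) = 1 - s • (z + star z) + s ^ 2 • (star z * z) := by
      simp only [star_sub, star_one, star_smul, star_trivial, sub_mul, mul_sub, one_mul, mul_one,
        smul_mul_assoc, mul_smul_comm]
      module
    have h1 : s • algebraMap ℝ M ε ≤ s • (z + star z) := smul_le_smul_of_nonneg_left hz hs.le
    have h2 : s ^ 2 • (star z * z) ≤ s ^ 2 • algebraMap ℝ M (‖z‖ ^ 2) :=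
      smul_le_smul_of_nonneg_left CStarAlgebra.star_mul_le_algebraMap_norm_sq (by positivity)
    rw [e1]
    calc 1 - s • (z + star z) + s ^ 2 • (star z * z)
        ≤ 1 - s • algebraMap ℝ M ε + s ^ 2 • algebraMap ℝ M (‖z‖ ^ 2) := by gcongr
      _ = algebraMap ℝ M (1 - s * ε + s ^ 2 * ‖z‖ ^ 2) := by
        simp only [map_add, map_sub, map_one, Algebra.algebraMap_eq_smul_one, smul_smul]
      _ ≤ _ := by
        apply algebraMap_mono
        refine le_max_of_le_left ?_
        nlinarith
  have hnorm : ‖1 - s • z‖ < 1 := by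
    have h1 := (CStarAlgebra.norm_le_iff_le_algebraMap _ (le_max_right _ _)
      (star_mul_self_nonneg (1 - s • z))).2 hle
    rw [CStarRing.norm_star_mul_self] at h1
    have h2 : max (1 - s * ε / 2) 0 < 1 := max_lt (by linarith [mul_pos hs hε]) one_pos
    nlinarith [norm_nonneg (1 - s • z)]
  have hu := isUnit_one_sub_of_norm_lt_one hnorm
  rw [sub_sub_cancel] at hu
  have := hu.smul (Units.mk0 s hs.ne')⁻¹
  simpa [Units.smul_def, smul_smul, hs.ne'] using this

theorem two_mul_norm_le_norm_exp_conj_add [PartialOrder M] [StarOrderedRing M] {c v : M}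
    (hc : IsSelfAdjoint c) (hv : IsSelfAdjoint v) :
    2 * ‖v‖ ≤ ‖exp c * v * exp (-c) + exp (-c) * v * exp c‖ := by
  nontriviality M
  by_contra! hlt
  let u : Mˣ := ⟨exp c, exp (-c), exp_mul_exp_neg c, exp_neg_mul_exp c⟩
  set X : M := exp c * v * exp (-c) with hX
  have hstar : star X = exp (-c) * v * exp c := by
    rw [hX, star_mul, star_mul, hv.star_eq, hc.exp.star_eq, hc.neg.exp.star_eq, mul_assoc]
  have hspec : spectrum ℝ X = spectrum ℝ v := spectrum.units_conjugate (u := u)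
  rw [← hstar] at hlt
  have hsa : IsSelfAdjoint (X + star X) := IsSelfAdjoint.add_star_self X
  have hε : 0 < 2 * ‖v‖ - ‖X + star X‖ := by linarith
  have h2 : algebraMap ℝ M (2 * ‖v‖) = algebraMap ℝ M ‖v‖ + algebraMap ℝ M ‖v‖ := by
    rw [two_mul, map_add]
  have hstar' : star (algebraMap ℝ M ‖v‖) = algebraMap ℝ M ‖v‖ := by
    rw [← algebraMap_star_comm, star_trivial]
  rcases CStarAlgebra.norm_or_neg_norm_mem_spectrum hv with h | h
  · rw [← hspec, spectrum.mem_iff] at h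
    refine h (isUnit_of_algebraMap_le_add_star hε ?_)
    have := hsa.le_algebraMap_norm_self
    rw [map_sub, star_sub, hstar', h2]
    calc _ ≤ algebraMap ℝ M ‖v‖ + algebraMap ℝ M ‖v‖ - (X + star X) := by gcongr
      _ = _ := by abel
  · rw [← hspec, spectrum.mem_iff, ← IsUnit.neg_iff] at h
    refine h (isUnit_of_algebraMap_le_add_star hε ?_)
    have := hsa.neg_algebraMap_norm_le_self
    rw [map_neg, map_sub, star_neg, star_sub, star_neg, hstar', h2]
    calc _ = algebraMap ℝ M ‖v‖ + algebraMap ℝ M ‖v‖ + -algebraMap ℝ M ‖X + star X‖ := by abel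
      _ ≤ algebraMap ℝ M ‖v‖ + algebraMap ℝ M ‖v‖ + (X + star X) := by gcongr
      _ = _ := by abel

theorem isLieTripleSystem_selfAdjoint : IsLieTripleSystem (selfAdjoint.submodule ℝ M) := by
  intro x hx y hy
  have hx' : star x = x := hx
  have hy' : star y = y := hy
  change star _ = _
  simp only [Ring.lie_def, star_sub, star_mul, hx', hy']
  noncomm_ring

theorem isSelfAdjoint_sinhcAd {c v : M} (hc : IsSelfAdjoint c) (hv : IsSelfAdjoint v) :
    IsSelfAdjoint (sinhcAd c v) :=
  sinhcAd_mem (H := selfAdjoint.submodule ℝ M)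
    (isClosed_eq continuous_star continuous_id) (isLieTripleSystem_selfAdjoint c hc) hv

theorem norm_le_norm_sinhcAd [PartialOrder M] [StarOrderedRing M] {c v : M}
    (hc : IsSelfAdjoint c) (hv : IsSelfAdjoint v) : ‖v‖ ≤ ‖sinhcAd c v‖ := by
  have hsm : ∀ r : ℝ, IsSelfAdjoint (r • c) := fun r => IsSelfAdjoint.smul (.all r) hc
  have hhalf : ∀ r : ℝ, ‖sinhcAd ((r / 2) • c) v‖ ≤ ‖sinhcAd (r • c) v‖ := by
    intro r
    have h := two_mul_norm_le_norm_exp_conj_add (hsm (1 / 4 * r))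
      (isSelfAdjoint_sinhcAd (hsm (1 / 2 * r)) hv)
    rw [sinhcAd_smul_half (r • c) v, norm_smul, smul_smul, smul_smul]
    rw [show r / 2 = 1 / 2 * r by ring]
    norm_num at h ⊢
    linarith
  have hpow : ∀ n : ℕ, ‖sinhcAd (((1 / 2 : ℝ) ^ n) • c) v‖ ≤ ‖sinhcAd c v‖ := by
    intro n
    induction n with
    | zero => simp
    | succ n ih =>
      refine le_trans ?_ ih
      have := hhalf ((1 / 2 : ℝ) ^ n)
      rwa [show (1 / 2 : ℝ) ^ n / 2 = (1 / 2) ^ (n + 1) by ring] at this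
  have hcont : Continuous fun r : ℝ => ‖(sinhcAd (r • c) : M →L[ℝ] M) v‖ := by
    have := continuous_sinhcAd (A := M)
    fun_prop
  have hlim := (hcont.tendsto 0).comp
    (tendsto_pow_atTop_nhds_zero_of_lt_one (r := (1 / 2 : ℝ)) (by norm_num) (by norm_num))
  rw [zero_smul, sinhcAd_zero] at hlim
  exact le_of_tendsto hlim (Filter.Eventually.of_forall hpow)

/-- On a closed Lie triple system `sinhcAd c` is onto, with a norm-decreasing inverse. -/
theorem exists_sinhcAd_eq [PartialOrder M] [StarOrderedRing M] {H : Submodule ℝ M}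
    (hsa : H ≤ selfAdjoint.submodule ℝ M) (hclosed : IsClosed (H : Set M))
    (hH : IsLieTripleSystem H) {c w : M} (hc : c ∈ H) (hw : w ∈ H) :
    ∃ v ∈ H, sinhcAd c v = w ∧ ‖v‖ ≤ ‖w‖ := by
  have hmem : ∀ r : ℝ, ∀ v ∈ H, sinhcAd (r • c) v ∈ H := fun r v hv =>
    sinhcAd_mem hclosed (hH _ (H.smul_mem r hc)) hv
  have hbelow : ∀ r : ℝ, ∀ v ∈ H, ‖v‖ ≤ ‖sinhcAd (r • c) v‖ := fun r v hv =>
    norm_le_norm_sinhcAd (hsa (H.smul_mem r hc)) (hsa hv)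
  have : CompleteSpace H := hclosed.completeSpace_coe
  let T : ℝ → H →L[ℝ] H := fun r =>
    ((sinhcAd (r • c)).comp H.subtypeL).codRestrict H fun v => hmem r v v.2
  have hTapp : ∀ r v, (T r v : M) = sinhcAd (r • c) v := fun r v => rfl
  have hT : Continuous T := by
    have hcont : Continuous fun r : ℝ => (sinhcAd (r • c) : M →L[ℝ] M) :=
      continuous_sinhcAd.comp (continuous_id.smul continuous_const)
    rw [continuous_iff_continuousAt]
    intro r
    have h0 : Filter.Tendsto (fun s : ℝ => ‖(sinhcAd (s • c) : M →L[ℝ] M) - sinhcAd (r • c)‖)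
        (nhds r) (nhds 0) := by
      simpa using ((hcont.sub (continuous_const (y := sinhcAd (r • c)))).norm).tendsto r
    refine (tendsto_iff_norm_sub_tendsto_zero (E := H →L[ℝ] H) (f := T) (b := T r)).2 ?_
    refine squeeze_zero (fun s => norm_nonneg (T s - T r)) (fun s => ?_) h0
    refine ContinuousLinearMap.opNorm_le_bound _ (norm_nonneg _) fun v => ?_
    exact ((sinhcAd (s • c) : M →L[ℝ] M) - sinhcAd (r • c)).le_opNorm v
  have hu := isUnit_of_continuous_of_norm_le hT (by ext v; simp [hTapp, sinhcAd_zero])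
    (fun r v => hbelow r v v.2) 1
  obtain ⟨u, hu⟩ := hu
  let v : H := (↑u⁻¹ : H →L[ℝ] H) ⟨w, hw⟩
  have hv : T 1 v = ⟨w, hw⟩ := by
    rw [← hu, ← mul_apply_eq_comp, u.mul_inv, one_apply_eq_self]
  have hv' : sinhcAd c (v : M) = w := by
    have := congrArg Subtype.val hv
    rwa [hTapp, one_smul] at this
  refine ⟨v, v.2, hv', ?_⟩
  have := hbelow 1 v v.2
  rwa [one_smul, hv'] at this

end CStar

section Euler

open NormedSpace

variable {M : Type*} [CStarAlgebra M]

theorem exp_half_mul_exp_half (c : M) :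
    exp ((1 / 2 : ℝ) • c) * exp ((1 / 2 : ℝ) • c) = exp c := by
  rw [← exp_add_smul]
  norm_num

theorem norm_exp_mul_mul_exp_sub_le [Nontrivial M] (x b : M) {h : ℝ} (h0 : 0 ≤ h) (h1 : h ≤ 1) :
    ‖exp (h • x) * b * exp (h • x) - b - h • (b * x + x * b)‖ ≤
      3 * Real.exp (4 * ‖x‖) * ‖x‖ ^ 2 * ‖b‖ * h ^ 2 := by
  have hhx : ‖h • x‖ ≤ ‖x‖ := by
    rw [norm_smul, Real.norm_of_nonneg h0]
    exact mul_le_of_le_one_left (norm_nonneg x) h1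
  set E := exp (h • x)
  have hd : dexp (0 : M) (h • x) = h • x := by
    rw [dexp_apply_eq_mul_sinhcAd_mul, sinhcAd_zero]
    simp
  have r2 : ‖E - 1 - h • x‖ ≤ Real.exp (3 * ‖x‖) * (‖x‖ ^ 2 * h ^ 2) := by
    have := norm_exp_add_sub_exp_sub_dexp_le (0 : M) (h • x)
    rw [hd, zero_add, exp_zero, norm_zero, zero_add] at this
    refine this.trans ?_
    gcongr
    rw [norm_smul, Real.norm_of_nonneg h0, mul_pow, mul_comm]
  have r1 : ‖E - 1‖ ≤ Real.exp (2 * ‖x‖) * (‖x‖ * h) := by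
    have := norm_exp_add_sub_exp_le (0 : M) (h • x)
    rw [zero_add, exp_zero, norm_zero, zero_add] at this
    refine this.trans ?_
    gcongr
    rw [norm_smul, Real.norm_of_nonneg h0, mul_comm]
  have r0 : ‖E‖ ≤ Real.exp ‖x‖ := norm_exp_smul_le x le_rfl (abs_le.2 ⟨by linarith, h1⟩)
  have e : E * b * E - b - h • (b * x + x * b) =
      (E - 1 - h • x) * b * E + b * (E - 1 - h • x) + (h • x) * b * (E - 1) := by
    simp only [smul_add, sub_mul, mul_sub, smul_mul_assoc, mul_smul_comm, one_mul, mul_one]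
    abel
  have l3 : Real.exp (3 * ‖x‖) ≤ Real.exp (4 * ‖x‖) := by
    gcongr; norm_num
  have l2 : Real.exp (2 * ‖x‖) ≤ Real.exp (4 * ‖x‖) := by
    gcongr; norm_num
  have l4 : Real.exp (3 * ‖x‖) * Real.exp ‖x‖ = Real.exp (4 * ‖x‖) := by
    rw [← Real.exp_add]; ring_nf
  rw [e]
  calc _ ≤ ‖(E - 1 - h • x) * b * E‖ + ‖b * (E - 1 - h • x)‖ + ‖(h • x) * b * (E - 1)‖ :=
        norm_add₃_le
    _ ≤ ‖E - 1 - h • x‖ * ‖b‖ * ‖E‖ + ‖b‖ * ‖E - 1 - h • x‖ + ‖h • x‖ * ‖b‖ * ‖E - 1‖ := by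
        gcongr
        · exact norm_mul₃_le
        · exact norm_mul_le _ _
        · exact norm_mul₃_le
    _ ≤ (Real.exp (3 * ‖x‖) * (‖x‖ ^ 2 * h ^ 2)) * ‖b‖ * Real.exp ‖x‖ +
        ‖b‖ * (Real.exp (4 * ‖x‖) * (‖x‖ ^ 2 * h ^ 2)) +
        (h * ‖x‖) * ‖b‖ * (Real.exp (4 * ‖x‖) * (‖x‖ * h)) := by
        gcongr
        · exact r2.trans (by gcongr)
        · rw [norm_smul, Real.norm_of_nonneg h0]
        · exact r1.trans (by gcongr)
    _ = _ := by rw [← l4]; ring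

theorem exp_norm_le_max [Nontrivial M] {c : M} (hc : IsSelfAdjoint c) :
    Real.exp ‖c‖ ≤ max ‖exp c‖ ‖exp (-c)‖ := by
  have key : ∀ a : M, ‖c‖ ∈ spectrum ℝ a → Real.exp ‖c‖ ≤ ‖exp a‖ := by
    intro a ha
    have := spectrum.norm_le_norm_of_mem (spectrum.exp_mem_exp a ha)
    rwa [← Real.exp_eq_exp_ℝ, Real.norm_of_nonneg (Real.exp_nonneg _)] at this
  rcases CStarAlgebra.norm_or_neg_norm_mem_spectrum hc with h | h
  · exact le_max_of_le_left (key c h)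
  · refine le_max_of_le_right (key (-c) ?_)
    rw [← spectrum.neg_eq]
    simpa using h

theorem exists_norm_le_of_norm_exp_conj_sub_le [Nontrivial M] (x y : M) :
    ∃ δ > 0, ∃ R : ℝ, ∀ c : M, IsSelfAdjoint c → ∀ t : ℝ, 0 ≤ t → t ≤ 1 →
      ‖exp ((-t) • x) * exp c * exp ((-t) • x) - exp y‖ ≤ δ → ‖c‖ ≤ R := by
  set N := ‖exp (-y)‖ with hN
  set X := Real.exp ‖x‖ with hX
  have hN0 : 0 ≤ N := norm_nonneg _
  set δ : ℝ := 1 / (2 * (N + 1)) with hδ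
  have hδ0 : 0 < δ := by positivity
  have hδN : δ * N ≤ 1 / 2 := by
    have : δ * (N + 1) = 1 / 2 := by rw [hδ]; field_simp
    linarith
  refine ⟨δ, hδ0, Real.log (max (X * (‖exp y‖ + δ) * X) (X * (2 * N) * X)), ?_⟩
  intro c hc t h0 h1 ht
  set e := exp (t • x)
  set f := exp ((-t) • x)
  have he : ‖e‖ ≤ X := norm_exp_smul_le x le_rfl (abs_le.2 ⟨by linarith, h1⟩)
  have hf : ‖f‖ ≤ X := norm_exp_smul_le x le_rfl (abs_le.2 ⟨by linarith, by linarith⟩)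
  have hef : e * f = 1 := by
    rw [← exp_add_smul]; simp
  have hfe : f * e = 1 := by
    rw [← exp_add_smul]; simp
  set g := f * exp c * f
  set g' := e * exp (-c) * e
  have hgg : g' * g = 1 := by
    calc g' * g = e * exp (-c) * (e * f) * exp c * f := by simp only [g, g', mul_assoc]
      _ = 1 := by rw [hef, mul_one, mul_assoc e, exp_neg_mul_exp, mul_one, hef]
  have hg : ‖g‖ ≤ ‖exp y‖ + δ := by
    calc ‖g‖ = ‖exp y + (g - exp y)‖ := by congr 1; abel
      _ ≤ _ := (norm_add_le _ _).trans (by gcongr)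
  have hg' : ‖g'‖ ≤ 2 * N := by
    have e1 : g' = exp (-y) - g' * (g - exp y) * exp (-y) := by
      rw [mul_sub, hgg, sub_mul, mul_assoc g', exp_mul_exp_neg]
      simp
    have e2 : ‖g'‖ ≤ N + ‖g'‖ * δ * N := by
      calc ‖g'‖ = ‖exp (-y) - g' * (g - exp y) * exp (-y)‖ := by rw [← e1]
        _ ≤ _ := (norm_sub_le _ _).trans (by
          gcongr
          exact norm_mul₃_le.trans (by gcongr))
    nlinarith [norm_nonneg g']
  have c1 : exp c = e * g * e := by
    calc exp c = (e * f) * exp c * (f * e) := by rw [hef, hfe, one_mul, mul_one]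
      _ = _ := by simp only [g, mul_assoc]
  have c2 : exp (-c) = f * g' * f := by
    calc exp (-c) = (f * e) * exp (-c) * (e * f) := by rw [hef, hfe, one_mul, mul_one]
      _ = _ := by simp only [g', mul_assoc]
  have hX0 : 0 ≤ X := Real.exp_nonneg _
  have := exp_norm_le_max hc
  refine (Real.le_log_iff_exp_le ?_).2 (this.trans (max_le_max ?_ ?_))
  · refine lt_max_of_lt_left ?_
    positivity
  · rw [c1]
    exact norm_mul₃_le.trans (by gcongr)
  · rw [c2]
    exact norm_mul₃_le.trans (by gcongr)

variable [PartialOrder M] [StarOrderedRing M] {H : Submodule ℝ M}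

/-- One Euler step: up to an error of second order, `exp H` is invariant under
`b ↦ exp (h x) b exp (h x)`. -/
theorem exists_norm_exp_sub_le [Nontrivial M] (hsa : H ≤ selfAdjoint.submodule ℝ M)
    (hclosed : IsClosed (H : Set M)) (hH : IsLieTripleSystem H) {x : M} (hx : x ∈ H) {R : ℝ} :
    ∃ C : ℝ, 0 ≤ C ∧ ∀ c ∈ H, ‖c‖ ≤ R → ∀ h : ℝ, 0 ≤ h → h ≤ 1 →
      ∃ c' ∈ H, ‖exp c' - exp (h • x) * exp c * exp (h • x)‖ ≤ C * h ^ 2 := by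
  set W : ℝ := 2 * (Real.exp R * ‖x‖ * Real.exp R) with hW
  refine ⟨Real.exp (3 * (R + W)) * W ^ 2 + 3 * Real.exp (4 * ‖x‖) * ‖x‖ ^ 2 * Real.exp R,
    by positivity, fun c hc hcR h h0 h1 => ?_⟩
  have hW0 : 0 ≤ W := by positivity
  set P := exp ((1 / 2 : ℝ) • c)
  set N := exp (-((1 / 2 : ℝ) • c))
  have hP : ‖P‖ ≤ Real.exp R := norm_exp_smul_le c hcR (by norm_num [abs_le])
  have hN : ‖N‖ ≤ Real.exp R := by
    have := norm_exp_smul_le c (s := -(1 / 2)) hcR (by norm_num [abs_le])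
    rwa [neg_smul] at this
  have hPN : P * N = 1 := exp_mul_exp_neg _
  have hNP : N * P = 1 := exp_neg_mul_exp _
  have hPP : P * P = exp c := exp_half_mul_exp_half c
  obtain ⟨v, hv, hSv, hvw⟩ := exists_sinhcAd_eq hsa hclosed hH hc
    (exp_conj_add_exp_neg_conj_mem hclosed (hH _ (H.smul_mem (1 / 2 : ℝ) hc)) hx)
  have hvW : ‖v‖ ≤ W := by
    refine hvw.trans ((norm_add_le _ _).trans ?_)
    have a1 : ‖P * x * N‖ ≤ Real.exp R * ‖x‖ * Real.exp R :=
      norm_mul₃_le.trans (by gcongr)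
    have a2 : ‖N * x * P‖ ≤ Real.exp R * ‖x‖ * Real.exp R :=
      norm_mul₃_le.trans (by gcongr)
    linarith
  have hd : dexp c v = exp c * x + x * exp c := by
    rw [dexp_apply_eq_mul_sinhcAd_mul, hSv, ← hPP]
    change P * (P * x * N + N * x * P) * P = _
    calc _ = P * P * x * (N * P) + (P * N) * x * (P * P) := by noncomm_ring
      _ = _ := by rw [hPN, hNP, mul_one, one_mul]
  refine ⟨c + h • v, H.add_mem hc (H.smul_mem h hv), ?_⟩
  have hhv : ‖h • v‖ ≤ h * W := by
    rw [norm_smul, Real.norm_of_nonneg h0]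
    gcongr
  have q1 := norm_exp_add_sub_exp_sub_dexp_le c (h • v)
  rw [map_smul, hd] at q1
  have q2 := norm_exp_mul_mul_exp_sub_le x (exp c) h0 h1
  have hec : ‖exp c‖ ≤ Real.exp R :=
    (norm_exp_le_exp_norm_of_real c).trans (Real.exp_le_exp.2 hcR)
  calc ‖exp (c + h • v) - exp (h • x) * exp c * exp (h • x)‖
      = ‖(exp (c + h • v) - exp c - h • (exp c * x + x * exp c)) -
        (exp (h • x) * exp c * exp (h • x) - exp c - h • (exp c * x + x * exp c))‖ := by
        congr 1; abel
    _ ≤ Real.exp (3 * (‖c‖ + ‖h • v‖)) * ‖h • v‖ ^ 2 +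
        3 * Real.exp (4 * ‖x‖) * ‖x‖ ^ 2 * ‖exp c‖ * h ^ 2 :=
        (norm_sub_le _ _).trans (add_le_add q1 q2)
    _ ≤ Real.exp (3 * (R + W)) * (h * W) ^ 2 +
        3 * Real.exp (4 * ‖x‖) * ‖x‖ ^ 2 * Real.exp R * h ^ 2 := by
        have : ‖h • v‖ ≤ W := hhv.trans (mul_le_of_le_one_left hW0 h1)
        gcongr
    _ = _ := by ring

theorem isStrictlyPositive_exp {c : M} (hc : IsSelfAdjoint c) : IsStrictlyPositive (exp c) := by
  let +nondep : NormedAlgebra ℚ M := .restrictScalars ℚ ℝ M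
  exact (isUnit_exp c).isStrictlyPositive hc.exp_nonneg

theorem isStrictlyPositive_exp_mul_exp_mul_exp {x y : M} (hx : IsSelfAdjoint x)
    (hy : IsSelfAdjoint y) : IsStrictlyPositive (exp x * exp y * exp x) := by
  refine IsUnit.isStrictlyPositive ?_ (hx.exp.conjugate_nonneg hy.exp_nonneg)
  exact ((isStrictlyPositive_exp hx).isUnit.mul (isStrictlyPositive_exp hy).isUnit).mul
    (isStrictlyPositive_exp hx).isUnit

theorem exp_rpow {c : M} (hc : IsSelfAdjoint c) (t : ℝ) : exp c ^ t = exp (t • c) := by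
  rw [← CFC.real_exp_eq_normedSpace_exp hc, CFC.cfc_rpow (fun x _ => Real.exp_pos x),
    ← CFC.real_exp_eq_normedSpace_exp (IsSelfAdjoint.smul (.all t) hc),
    ← cfc_smul_id (R := ℝ) t c, ← cfc_comp Real.exp (t • ·) c]
  refine cfc_congr fun x _ => ?_
  simp [← Real.exp_mul, mul_comm]

theorem exists_exp_eq_exp_mul_exp_mul_exp [Nontrivial M] (hsa : H ≤ selfAdjoint.submodule ℝ M)
    (hclosed : IsClosed (H : Set M)) (hH : IsLieTripleSystem H) {x y : M} (hx : x ∈ H)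
    (hy : y ∈ H) : ∃ z ∈ H, exp z = exp x * exp y * exp x := by
  obtain ⟨δ, hδ, R, hR⟩ := exists_norm_le_of_norm_exp_conj_sub_le x y
  obtain ⟨C, hC, hstep⟩ := exists_norm_exp_sub_le hsa hclosed hH hx (R := R)
  set X := Real.exp ‖x‖
  have hX0 : 0 ≤ X := Real.exp_nonneg _
  set C' := X * C * X
  have hC' : 0 ≤ C' := by positivity
  have happrox : ∀ n : ℕ, 0 < n → C' / n ≤ δ → ∀ k : ℕ, k ≤ n → ∃ c ∈ H,
      ‖exp ((-(k / n : ℝ)) • x) * exp c * exp ((-(k / n : ℝ)) • x) - exp y‖ ≤ C' * k / n ^ 2 := by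
    intro n hn hnδ k
    have hn' : (0 : ℝ) < n := Nat.cast_pos.2 hn
    induction k with
    | zero => intro _; exact ⟨y, hy, by simp⟩
    | succ k ih =>
      intro hk
      obtain ⟨c, hc, hck⟩ := ih (by omega)
      have hkn : (k : ℝ) + 1 ≤ n := by exact_mod_cast hk
      have hcR : ‖c‖ ≤ R := by
        refine hR c (hsa hc) (k / n) (by positivity) ((div_le_one hn').2 (by linarith))
          (hck.trans (le_trans ?_ hnδ))
        rw [div_le_div_iff₀ (by positivity) hn']
        nlinarith [mul_nonneg hC' hn'.le]
      obtain ⟨c', hc', hcc⟩ := hstep c hc hcR (1 / n) (by positivity)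
        ((div_le_one hn').2 (by linarith [(Nat.cast_nonneg k : (0 : ℝ) ≤ k)]))
      refine ⟨c', hc', ?_⟩
      set s : ℝ := -((k + 1 : ℕ) / n : ℝ) with hs
      have e1 : s + 1 / n = -(k / n : ℝ) := by
        rw [hs]; push_cast; field_simp; ring
      have e2 : (1 / n : ℝ) + s = -(k / n : ℝ) := by rw [← e1]; ring
      have hsn : ‖exp (s • x)‖ ≤ X := by
        refine norm_exp_smul_le x le_rfl ?_
        rw [hs, abs_neg, abs_of_nonneg (by positivity), div_le_one hn']
        exact_mod_cast hk
      have e3 : exp (s • x) * exp c' * exp (s • x) - exp y =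
          exp (s • x) * (exp c' - exp ((1 / n : ℝ) • x) * exp c * exp ((1 / n : ℝ) • x)) *
            exp (s • x) +
          (exp ((-(k / n : ℝ)) • x) * exp c * exp ((-(k / n : ℝ)) • x) - exp y) := by
        have p1 : exp ((-(k / n : ℝ)) • x) = exp (s • x) * exp ((1 / n : ℝ) • x) := by
          rw [← exp_add_smul, e1]
        have p2 : exp ((-(k / n : ℝ)) • x) = exp ((1 / n : ℝ) • x) * exp (s • x) := by
          rw [← exp_add_smul, e2]
        have : exp ((-(k / n : ℝ)) • x) * exp c * exp ((-(k / n : ℝ)) • x) =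
            exp (s • x) * (exp ((1 / n : ℝ) • x) * exp c * exp ((1 / n : ℝ) • x)) *
              exp (s • x) := by
          calc _ = exp (s • x) * exp ((1 / n : ℝ) • x) * exp c *
                (exp ((1 / n : ℝ) • x) * exp (s • x)) := by rw [← p1, ← p2]
            _ = _ := by simp only [mul_assoc]
        rw [this, mul_sub, sub_mul]
        abel
      rw [e3]
      refine (norm_add_le _ _).trans ((add_le_add (norm_mul₃_le.trans
        (mul_le_mul (mul_le_mul hsn hcc (norm_nonneg _) hX0) hsn (norm_nonneg _) ?_)) hck).trans
        (le_of_eq ?_))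
      · positivity
      · push_cast
        simp only [C']
        field_simp
        ring
  have hseq : ∀ n : ℕ, ∃ c ∈ H, 0 < n → C' / n ≤ δ →
      ‖exp (-x) * exp c * exp (-x) - exp y‖ ≤ C' / n := by
    intro n
    by_cases h : 0 < n ∧ C' / n ≤ δ
    · obtain ⟨c, hc, hcn⟩ := happrox n h.1 h.2 n le_rfl
      have hn' : (n : ℝ) ≠ 0 := Nat.cast_ne_zero.2 h.1.ne'
      refine ⟨c, hc, fun _ _ => ?_⟩
      rw [div_self hn', neg_smul, one_smul] at hcn
      refine hcn.trans (le_of_eq ?_)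
      field_simp
    · exact ⟨0, H.zero_mem, fun h1 h2 => (h ⟨h1, h2⟩).elim⟩
  choose c hc hcn using hseq
  have hlim0 : Filter.Tendsto (fun n : ℕ => C' / n) Filter.atTop (nhds 0) :=
    tendsto_const_div_atTop_nhds_zero_nat C'
  have hlim1 : Filter.Tendsto (fun n => exp (-x) * exp (c n) * exp (-x)) Filter.atTop
      (nhds (exp y)) := by
    refine tendsto_iff_norm_sub_tendsto_zero.2 (squeeze_zero' (Filter.Eventually.of_forall
      fun n => norm_nonneg _) ?_ hlim0)
    filter_upwards [Filter.eventually_gt_atTop 0, hlim0.eventually_le_const hδ] with n h1 h2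
    exact hcn n h1 h2
  have hlim2 : Filter.Tendsto (fun n => exp (c n)) Filter.atTop
      (nhds (exp x * exp y * exp x)) := by
    refine ((hlim1.const_mul (exp x)).mul_const (exp x)).congr fun n => ?_
    calc _ = (exp x * exp (-x)) * exp (c n) * (exp (-x) * exp x) := by simp only [mul_assoc]
      _ = _ := by rw [exp_mul_exp_neg, exp_neg_mul_exp, one_mul, mul_one]
  have hb : IsStrictlyPositive (exp x * exp y * exp x) :=
    isStrictlyPositive_exp_mul_exp_mul_exp (hsa hx) (hsa hy)
  have hlog := (CFC.continuousOn_log (A := M)) (exp x * exp y * exp x)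
    ⟨hb.isSelfAdjoint, hb.isUnit⟩
  have hlim3 : Filter.Tendsto (fun n => CFC.log (exp (c n))) Filter.atTop
      (nhds (CFC.log (exp x * exp y * exp x))) :=
    hlog.tendsto.comp (tendsto_nhdsWithin_iff.2 ⟨hlim2, Filter.Eventually.of_forall fun n =>
      ⟨(isStrictlyPositive_exp (hsa (hc n))).isSelfAdjoint,
        (isStrictlyPositive_exp (hsa (hc n))).isUnit⟩⟩)
  refine ⟨_, hclosed.mem_of_tendsto hlim3 (Filter.Eventually.of_forall fun n => ?_),
    CFC.exp_log _ hb⟩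
  rw [CFC.log_exp (c n) (hsa (hc n))]
  exact hc n

theorem geodesicCurve_exp {x y : M} (hx : IsSelfAdjoint x) (t : ℝ) :
    geodesicCurve (exp x) (exp y) t = exp ((1 / 2 : ℝ) • x) *
      (exp (-((1 / 2 : ℝ) • x)) * exp y * exp (-((1 / 2 : ℝ) • x))) ^ t *
        exp ((1 / 2 : ℝ) • x) := by
  rw [geodesicCurve, exp_rpow hx, exp_rpow hx, neg_smul]

theorem isGeodesicallyConvex_of_isLieTripleSystem [Nontrivial M]
    (hsa : H ≤ selfAdjoint.submodule ℝ M) (hclosed : IsClosed (H : Set M))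
    (hH : IsLieTripleSystem H) : IsGeodesicallyConvex (exp '' (H : Set M)) := by
  rintro _ ⟨x, hx, rfl⟩ _ ⟨y, hy, rfl⟩ t -
  obtain ⟨z, hz, hze⟩ := exists_exp_eq_exp_mul_exp_mul_exp hsa hclosed hH
    (H.neg_mem (H.smul_mem (1 / 2 : ℝ) hx)) hy
  rw [geodesicCurve_exp (hsa hx), ← hze, exp_rpow (hsa hz)]
  exact exists_exp_eq_exp_mul_exp_mul_exp hsa hclosed hH (H.smul_mem (1 / 2 : ℝ) hx)
    (H.smul_mem t hz)

end Euler

section CubicJet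

open NormedSpace Asymptotics Topology

theorem isBigO_one_of_continuous {E : Type*} [NormedAddCommGroup E] {f : ℝ → E}
    (hf : Continuous f) : f =O[𝓝 0] fun _ => (1 : ℝ) :=
  (hf.tendsto 0).isBigO_one ℝ

variable {A : Type*} [NormedRing A] [NormedAlgebra ℝ A]

/-- `f ε = a₀ + ε a₁ + ε² a₂ + ε³ a₃ + O(ε⁴)` as `ε → 0`. -/
def HasCubicJet (f : ℝ → A) (a₀ a₁ a₂ a₃ : A) : Prop :=
  (fun ε : ℝ => f ε - (a₀ + ε • a₁ + ε ^ 2 • a₂ + ε ^ 3 • a₃)) =O[𝓝 0] fun ε : ℝ => ε ^ 4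

namespace HasCubicJet

variable {f g : ℝ → A} {a₀ a₁ a₂ a₃ b₀ b₁ b₂ b₃ : A}

theorem congr_coeff (hf : HasCubicJet f a₀ a₁ a₂ a₃) (h₀ : a₀ = b₀) (h₁ : a₁ = b₁) (h₂ : a₂ = b₂)
    (h₃ : a₃ = b₃) : HasCubicJet f b₀ b₁ b₂ b₃ := by
  subst h₀ h₁ h₂ h₃
  exact hf

theorem add (hf : HasCubicJet f a₀ a₁ a₂ a₃) (hg : HasCubicJet g b₀ b₁ b₂ b₃) :
    HasCubicJet (fun ε => f ε + g ε) (a₀ + b₀) (a₁ + b₁) (a₂ + b₂) (a₃ + b₃) := by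
  refine (IsBigO.add hf hg).congr_left fun ε => ?_
  module

theorem const_smul (hf : HasCubicJet f a₀ a₁ a₂ a₃) (r : ℝ) :
    HasCubicJet (fun ε => r • f ε) (r • a₀) (r • a₁) (r • a₂) (r • a₃) := by
  refine (IsBigO.const_smul_left hf r).congr_left fun ε => ?_
  simp only [Pi.smul_apply]
  module

theorem polynomial (a₀ a₁ a₂ a₃ : A) :
    HasCubicJet (fun ε => a₀ + ε • a₁ + ε ^ 2 • a₂ + ε ^ 3 • a₃) a₀ a₁ a₂ a₃ := by
  simpa [HasCubicJet] using isBigO_zero _ _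

theorem isBigO_one (hf : HasCubicJet f a₀ a₁ a₂ a₃) : f =O[𝓝 0] fun _ => (1 : ℝ) := by
  have h1 : (fun ε : ℝ => a₀ + ε • a₁ + ε ^ 2 • a₂ + ε ^ 3 • a₃) =O[𝓝 0] fun _ => (1 : ℝ) :=
    isBigO_one_of_continuous (by fun_prop)
  have h2 : (fun ε : ℝ => ε ^ 4) =O[𝓝 0] fun _ => (1 : ℝ) :=
    ((continuous_pow 4).tendsto (0 : ℝ)).isBigO_one ℝ
  refine ((IsBigO.trans hf h2).add h1).congr_left fun ε => ?_
  abel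

theorem mul (hf : HasCubicJet f a₀ a₁ a₂ a₃) (hg : HasCubicJet g b₀ b₁ b₂ b₃) :
    HasCubicJet (fun ε => f ε * g ε) (a₀ * b₀) (a₀ * b₁ + a₁ * b₀)
      (a₀ * b₂ + a₁ * b₁ + a₂ * b₀) (a₀ * b₃ + a₁ * b₂ + a₂ * b₁ + a₃ * b₀) := by
  have h1 : (fun ε : ℝ => (f ε - (a₀ + ε • a₁ + ε ^ 2 • a₂ + ε ^ 3 • a₃)) * g ε)
      =O[𝓝 0] fun ε : ℝ => ε ^ 4 := by
    simpa using IsBigO.mul hf hg.isBigO_one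
  have h2 : (fun ε : ℝ => (a₀ + ε • a₁ + ε ^ 2 • a₂ + ε ^ 3 • a₃) *
      (g ε - (b₀ + ε • b₁ + ε ^ 2 • b₂ + ε ^ 3 • b₃))) =O[𝓝 0] fun ε : ℝ => ε ^ 4 := by
    simpa using IsBigO.mul (polynomial a₀ a₁ a₂ a₃).isBigO_one hg
  have h3 : (fun ε : ℝ => ε ^ 4 • ((a₁ * b₃ + a₂ * b₂ + a₃ * b₁) + ε • (a₂ * b₃ + a₃ * b₂) +
      ε ^ 2 • (a₃ * b₃))) =O[𝓝 0] fun ε : ℝ => ε ^ 4 := by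
    simpa using (isBigO_refl (fun ε : ℝ => ε ^ 4) (𝓝 0)).smul
      (isBigO_one_of_continuous (f := fun ε : ℝ => (a₁ * b₃ + a₂ * b₂ + a₃ * b₁) +
        ε • (a₂ * b₃ + a₃ * b₂) + ε ^ 2 • (a₃ * b₃)) (by fun_prop))
  refine ((h1.add h2).add h3).congr_left fun ε => ?_
  simp only [mul_add, add_mul, sub_mul, mul_sub, smul_mul_assoc, mul_smul_comm, smul_add,
    smul_smul]
  module

theorem cubic_coeff_mem {H : Submodule ℝ A} (hH : IsClosed (H : Set A)) {g : ℝ → A}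
    (hg : ∀ ε, g ε ∈ H) {u w : A} (hu : u ∈ H) (hj : HasCubicJet g 0 u 0 w) : w ∈ H := by
  have h1 : Filter.Tendsto (fun ε : ℝ => (ε ^ 3)⁻¹ • (g ε - ε • u)) (𝓝[≠] 0) (𝓝 w) := by
    have h2 : (fun ε : ℝ => (ε ^ 3)⁻¹ • (g ε - (0 + ε • u + ε ^ 2 • (0 : A) + ε ^ 3 • w)))
        =O[𝓝[≠] 0] fun ε : ℝ => ε := by
      refine ((isBigO_refl (fun ε : ℝ => (ε ^ 3)⁻¹) (𝓝[≠] 0)).smul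
        (IsBigO.mono hj nhdsWithin_le_nhds)).congr' (Filter.EventuallyEq.refl _ _) ?_
      filter_upwards [self_mem_nhdsWithin] with ε hε
      have : ε ≠ 0 := hε
      rw [smul_eq_mul]
      field_simp
    have h3 := (h2.trans_tendsto (tendsto_nhdsWithin_of_tendsto_nhds Filter.tendsto_id)).add_const w
    rw [zero_add] at h3
    refine h3.congr' ?_
    filter_upwards [self_mem_nhdsWithin] with ε hε
    have hε' : ε ^ 3 ≠ 0 := pow_ne_zero 3 hε
    rw [zero_add, smul_zero, add_zero, ← sub_sub, smul_sub _ _ (ε ^ 3 • w), inv_smul_smul₀ hε',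
      sub_add_cancel]
  exact hH.mem_of_tendsto h1 (Filter.Eventually.of_forall fun ε =>
    H.smul_mem _ (H.sub_mem (hg ε) (H.smul_mem ε hu)))

variable [CompleteSpace A]

theorem exp (u w : A) : HasCubicJet (fun ε => exp (ε • u + ε ^ 3 • w)) 1 u
    ((1 / 2 : ℝ) • (u * u)) ((1 / 6 : ℝ) • (u * u * u) + w) := by
  have hp : HasCubicJet (fun ε => ε • u + ε ^ 3 • w) 0 u 0 w := by
    simpa using polynomial 0 u 0 w
  have hT := (((polynomial (1 : A) 0 0 0).add hp).add ((hp.mul hp).const_smul (1 / 2))).add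
    (((hp.mul hp).mul hp).const_smul (1 / 6))
  have hpO : (fun ε : ℝ => ε • u + ε ^ 3 • w) =O[𝓝 0] fun ε : ℝ => ε := by
    have := (isBigO_refl (fun ε : ℝ => ε) (𝓝 0)).smul
      (isBigO_one_of_continuous (f := fun ε : ℝ => u + ε ^ 2 • w) (by fun_prop))
    refine this.congr (fun ε => ?_) (fun ε => by simp)
    module
  have hp0 : Filter.Tendsto (fun ε : ℝ => ε • u + ε ^ 3 • w) (𝓝 0) (𝓝 0) := by
    have : Continuous fun ε : ℝ => ε • u + ε ^ 3 • w := by fun_prop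
    simpa using this.tendsto 0
  have hE := ((exp_hasFPowerSeriesAt_zero (𝕂 := ℝ) (𝔸 := A)).isBigO_sub_partialSum_pow
    4).comp_tendsto hp0
  have hE' : (fun ε : ℝ => NormedSpace.exp (ε • u + ε ^ 3 • w) -
      (1 + (ε • u + ε ^ 3 • w) + (1 / 2 : ℝ) • ((ε • u + ε ^ 3 • w) * (ε • u + ε ^ 3 • w)) +
      (1 / 6 : ℝ) • ((ε • u + ε ^ 3 • w) * (ε • u + ε ^ 3 • w) * (ε • u + ε ^ 3 • w))))
      =O[𝓝 0] fun ε : ℝ => ε ^ 4 := by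
    refine (hE.trans (hpO.norm_left.pow 4)).congr_left fun ε => ?_
    simp only [Function.comp, zero_add, FormalMultilinearSeries.partialSum, expSeries_apply_eq,
      Finset.sum_range_succ, Finset.sum_range_zero]
    norm_num [Nat.factorial, pow_succ]
  have := (IsBigO.add hE' hT)
  refine this.congr_left fun ε => ?_
  simp only [zero_mul, mul_zero, smul_zero, add_zero, zero_add]
  module

end HasCubicJet

variable [CompleteSpace A]

theorem hasStrictFDerivAt_exp_mul_exp_mul_exp_zero :
    HasStrictFDerivAt (fun p : A × A => exp p.1 * exp p.2 * exp p.1)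
      ((2 : ℝ) • ContinuousLinearMap.fst ℝ A A + ContinuousLinearMap.snd ℝ A A) 0 := by
  have h1 : HasStrictFDerivAt (fun p : A × A => exp p.1) (ContinuousLinearMap.fst ℝ A A) 0 :=
    HasStrictFDerivAt.comp (f := fun p : A × A => p.1) (g := exp)
      (g' := (1 : A →L[ℝ] A)) (0 : A × A) hasStrictFDerivAt_exp_zero hasStrictFDerivAt_fst
  have h2 : HasStrictFDerivAt (fun p : A × A => exp p.2) (ContinuousLinearMap.snd ℝ A A) 0 :=
    HasStrictFDerivAt.comp (f := fun p : A × A => p.2) (g := exp)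
      (g' := (1 : A →L[ℝ] A)) (0 : A × A) hasStrictFDerivAt_exp_zero hasStrictFDerivAt_snd
  refine ((h1.mul' h2).mul' h1).congr_fderiv ?_
  ext p <;> simp [two_smul]

/-- The third-order expansion of `g` where `exp g` is the geometric mean of `exp (ε x)` and
`exp (ε y)`. -/
theorem hasCubicJet_of_exp_mul_exp_mul_exp_eq {x y : A} {g : ℝ → A}
    (hg0 : Filter.Tendsto g (𝓝 0) (𝓝 0))
    (hg : ∀ ε : ℝ, exp (g ε) * exp (-(ε • x)) * exp (g ε) = exp (ε • y)) :
    HasCubicJet g 0 ((1 / 2 : ℝ) • (x + y)) 0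
      ((-(1 / 48) : ℝ) • (⁅x, ⁅x, y⁆⁆ + ⁅y, ⁅y, x⁆⁆)) := by
  set u := (1 / 2 : ℝ) • (x + y) with hu
  set w := (-(1 / 48) : ℝ) • (⁅x, ⁅x, y⁆⁆ + ⁅y, ⁅y, x⁆⁆) with hw
  let p : ℝ → A := fun ε => ε • u + ε ^ 3 • w
  have hp0 : Filter.Tendsto p (𝓝 0) (𝓝 0) := by
    have : Continuous p := by fun_prop
    simpa [p] using this.tendsto 0
  have hjx : HasCubicJet (fun ε : ℝ => exp (-(ε • x))) 1 (-x) ((1 / 2 : ℝ) • (x * x))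
      (-((1 / 6 : ℝ) • (x * x * x))) := by
    simpa using HasCubicJet.exp (-x) 0
  have hjy : HasCubicJet (fun ε : ℝ => exp (ε • y)) 1 y ((1 / 2 : ℝ) • (y * y))
      ((1 / 6 : ℝ) • (y * y * y)) := by
    simpa using HasCubicJet.exp y 0
  have hjp := HasCubicJet.exp u w
  have hprod := (hjp.mul hjx).mul hjp
  have hdiff : (fun ε : ℝ => exp (ε • y) - exp (p ε) * exp (-(ε • x)) * exp (p ε))
      =O[𝓝 0] fun ε : ℝ => ε ^ 4 := by
    have := hjy.add (hprod.const_smul (-1))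
    refine IsBigO.congr_left (this.congr_coeff (b₀ := 0) (b₁ := 0) (b₂ := 0) (b₃ := 0)
      ?_ ?_ ?_ ?_) fun ε => ?_
    · simp
    · simp only [hu, one_mul, mul_one]
      module
    · simp only [hu, one_mul, mul_one, mul_add, add_mul, smul_mul_assoc, mul_smul_comm, mul_neg,
        neg_mul, smul_add, smul_neg, smul_smul]
      module
    · simp only [hu, hw, Ring.lie_def, one_mul, mul_one, mul_add, add_mul, sub_mul, mul_sub,
        smul_mul_assoc, mul_smul_comm, mul_neg, neg_mul, smul_add, smul_sub, smul_neg, smul_smul,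
        mul_assoc]
      module
    · simp [p, sub_eq_add_neg]
  have hstrict := (hasStrictFDerivAt_exp_mul_exp_mul_exp_zero (A := A)).isLittleO
  have htend : Filter.Tendsto (fun ε : ℝ => ((g ε, -(ε • x)), (p ε, -(ε • x)))) (𝓝 0)
      (𝓝 (((0 : A), (0 : A)), ((0 : A), (0 : A)))) := by
    have hx0 : Filter.Tendsto (fun ε : ℝ => -(ε • x)) (𝓝 0) (𝓝 0) := by
      have : Continuous fun ε : ℝ => -(ε • x) := by fun_prop
      simpa using this.tendsto 0
    exact (hg0.prodMk_nhds hx0).prodMk_nhds (hp0.prodMk_nhds hx0)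
  have hev := htend.eventually (hstrict.def (c := 1) one_pos)
  have hgp : (fun ε => g ε - p ε) =O[𝓝 0] fun ε : ℝ => ε ^ 4 := by
    refine IsBigO.trans (IsBigO.of_bound 1 ?_) hdiff
    filter_upwards [hev] with ε hε
    simp only [Prod.mk_sub_mk, sub_self, hg, add_apply, smul_apply,
      ContinuousLinearMap.coe_fst', ContinuousLinearMap.coe_snd', add_zero, Prod.norm_mk,
      norm_zero, norm_nonneg, sup_of_le_left, one_mul] at hε
    rw [one_mul]
    set D := exp (ε • y) - exp (p ε) * exp (-(ε • x)) * exp (p ε)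
    have h2 : ‖(2 : ℝ) • (g ε - p ε)‖ = 2 * ‖g ε - p ε‖ := by
      rw [norm_smul]; norm_num
    have h3 : ‖(2 : ℝ) • (g ε - p ε)‖ ≤ ‖D‖ + ‖D - (2 : ℝ) • (g ε - p ε)‖ := by
      calc _ = ‖D - (D - (2 : ℝ) • (g ε - p ε))‖ := by rw [sub_sub_cancel]
        _ ≤ _ := norm_sub_le _ _
    linarith
  refine hgp.congr_left fun ε => ?_
  simp [p]

end CubicJet

section GeometricMean

open NormedSpace Topology

variable {M : Type*} [CStarAlgebra M] [PartialOrder M] [StarOrderedRing M] {H : Submodule ℝ M}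

theorem geodesicCurve_half_mul_exp_neg_mul {x y : M} (hx : IsSelfAdjoint x)
    (hy : IsSelfAdjoint y) :
    geodesicCurve (exp x) (exp y) (1 / 2) * exp (-x) * geodesicCurve (exp x) (exp y) (1 / 2) =
      exp y := by
  have hx2 : IsSelfAdjoint (-((1 / 2 : ℝ) • x)) := (IsSelfAdjoint.smul (.all _) hx).neg
  rw [geodesicCurve_exp hx]
  have hneg : exp (-x) = exp (-((1 / 2 : ℝ) • x)) * exp (-((1 / 2 : ℝ) • x)) := by
    rw [← smul_neg, exp_half_mul_exp_half]
  have hpos := isStrictlyPositive_exp_mul_exp_mul_exp hx2 hy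
  rw [hneg]
  set E := exp ((1 / 2 : ℝ) • x)
  set F := exp (-((1 / 2 : ℝ) • x))
  have hEF : E * F = 1 := exp_mul_exp_neg _
  have hFE : F * E = 1 := exp_neg_mul_exp _
  have hS : (F * exp y * F) ^ (1 / 2 : ℝ) * (F * exp y * F) ^ (1 / 2 : ℝ) = F * exp y * F := by
    rw [← CFC.rpow_add hpos.isUnit, add_halves, CFC.rpow_one _ hpos.nonneg]
  set S := (F * exp y * F) ^ (1 / 2 : ℝ)
  calc E * S * E * (F * F) * (E * S * E) = E * S * (E * F) * (F * E) * S * E := by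
        simp only [mul_assoc]
    _ = E * (S * S) * E := by rw [hEF, hFE]; simp only [mul_one, mul_assoc]
    _ = (E * F) * exp y * (F * E) := by rw [hS]; simp only [mul_assoc]
    _ = exp y := by rw [hEF, hFE, one_mul, mul_one]

theorem tendsto_geodesicCurve_exp_smul {x y : M} (hx : IsSelfAdjoint x) (hy : IsSelfAdjoint y)
    (t : ℝ) : Filter.Tendsto (fun ε : ℝ => geodesicCurve (exp (ε • x)) (exp (ε • y)) t)
      (𝓝 0) (𝓝 1) := by
  have hsm : ∀ (z : M), IsSelfAdjoint z → ∀ r : ℝ, IsSelfAdjoint (r • z) := fun z hz r =>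
    IsSelfAdjoint.smul (.all r) hz
  have hc := continuous_exp_of_real (A := M)
  have hE : Filter.Tendsto (fun ε : ℝ => exp ((1 / 2 : ℝ) • ε • x)) (𝓝 0) (𝓝 1) := by
    have : Continuous fun ε : ℝ => exp ((1 / 2 : ℝ) • ε • x) := by fun_prop
    simpa using this.tendsto 0
  have hI : Filter.Tendsto (fun ε : ℝ => exp (-((1 / 2 : ℝ) • ε • x)) * exp (ε • y) *
      exp (-((1 / 2 : ℝ) • ε • x))) (𝓝 0) (𝓝 1) := by
    have : Continuous fun ε : ℝ => exp (-((1 / 2 : ℝ) • ε • x)) * exp (ε • y) *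
      exp (-((1 / 2 : ℝ) • ε • x)) := by fun_prop
    simpa using this.tendsto 0
  have h1 : IsStrictlyPositive (1 : M) := by
    simp
  have hS := (CFC.continuousOn_rpow (A := M) t 1 h1).tendsto.comp
    (tendsto_nhdsWithin_iff.2 ⟨hI, Filter.Eventually.of_forall fun ε =>
      isStrictlyPositive_exp_mul_exp_mul_exp (hsm _ (hsm x hx ε) (1 / 2)).neg (hsm y hy ε)⟩)
  rw [CFC.one_rpow] at hS
  have := (hE.mul hS).mul hE
  rw [mul_one, mul_one] at this
  refine this.congr fun ε => ?_
  rw [geodesicCurve_exp (hsm x hx ε)]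
  rfl

theorem isLieTripleSystem_of_isGeodesicallyConvex
    (hsa : H ≤ selfAdjoint.submodule ℝ M) (hclosed : IsClosed (H : Set M))
    (hH : IsGeodesicallyConvex (exp '' (H : Set M))) : IsLieTripleSystem H := by
  have key : ∀ x ∈ H, ∀ y ∈ H, ⁅x, ⁅x, y⁆⁆ + ⁅y, ⁅y, x⁆⁆ ∈ H := by
    intro x hx y hy
    have hex : ∀ ε : ℝ, ∃ g ∈ H, exp g = geodesicCurve (exp (ε • x)) (exp (ε • y)) (1 / 2) :=
      fun ε => hH _ ⟨_, H.smul_mem ε hx, rfl⟩ _ ⟨_, H.smul_mem ε hy, rfl⟩ _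
        ⟨by norm_num, by norm_num⟩
    choose g hg hge using hex
    have hsm : ∀ (z : M), z ∈ H → ∀ r : ℝ, IsSelfAdjoint (r • z) := fun z hz r =>
      hsa (H.smul_mem r hz)
    have hlim : Filter.Tendsto g (𝓝 0) (𝓝 0) := by
      have h1 := tendsto_geodesicCurve_exp_smul (hsa hx) (hsa hy) (1 / 2)
      have h2 := (CFC.continuousOn_log (A := M) 1 ⟨IsSelfAdjoint.one M, isUnit_one⟩).tendsto.comp
        (tendsto_nhdsWithin_iff.2 ⟨h1, Filter.Eventually.of_forall fun ε => by
          rw [← hge ε]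
          have := isStrictlyPositive_exp (hsa (hg ε))
          exact ⟨this.isSelfAdjoint, this.isUnit⟩⟩)
      rw [CFC.log_one] at h2
      refine h2.congr fun ε => ?_
      rw [Function.comp, ← hge ε, CFC.log_exp _ (hsa (hg ε))]
    have hjet := hasCubicJet_of_exp_mul_exp_mul_exp_eq hlim fun ε => by
      rw [hge ε]
      exact geodesicCurve_half_mul_exp_neg_mul (hsm x hx ε) (hsm y hy ε)
    have hmem := hjet.cubic_coeff_mem hclosed hg (H.smul_mem _ (H.add_mem hx hy))
    simpa [smul_smul] using H.smul_mem (-48 : ℝ) hmem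
  intro x hx y hy
  have h := H.add_mem (key x hx y hy) (H.neg_mem (key x hx (-y) (H.neg_mem hy)))
  have e : ⁅x, ⁅x, y⁆⁆ = (1 / 2 : ℝ) • (⁅x, ⁅x, y⁆⁆ + ⁅y, ⁅y, x⁆⁆ +
      -(⁅x, ⁅x, -y⁆⁆ + ⁅-y, ⁅-y, x⁆⁆)) := by
    simp only [Ring.lie_def, mul_sub, sub_mul, mul_neg, neg_mul]
    module
  rw [e]
  exact H.smul_mem _ h

end GeometricMean

theorem mainTheorem3 {M : Type*} [CStarAlgebra M] [PartialOrder M] [StarOrderedRing M]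
    [WStarAlgebra M] (τ : M →ₗ[ℂ] ℂ) (hτ : IsFaithfulNormalTracialState τ)
    (H : Submodule ℝ M) (hsa : H ≤ selfAdjoint.submodule ℝ M) (hclosed : IsClosed (H : Set M)) :
    IsGeodesicallyConvex (NormedSpace.exp '' (H : Set M)) ↔ IsLieTripleSystem H := by
  have : Nontrivial M := ⟨1, 0, fun h => by simpa [h] using hτ.map_one⟩
  exact ⟨isLieTripleSystem_of_isGeodesicallyConvex hsa hclosed,
    isGeodesicallyConvex_of_isLieTripleSystem hsa hclosed⟩
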